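/- Let $H$ be a separable real reproducing kernel Hilbert space on a measurable space $\mathbb X$ with measurable kernel $k$ and feature map $\Phi(x)=k(x,\cdot)$. Let $(X_s)_{s\ge 0}$ be an $\mathbb X$-valued stochastic process, let $\mu$ be the law of $X_0$, let $\mu_{0,t}$ be the joint law of $(X_0,X_t)$ for a fixed $t\ge 0$, and assume $\int k(x,x)\,d\mu(x)<\infty$. For $x,y\in\mathbb X$ let $c_{yx}=\langle\Phi(x),\cdot\rangle_H\,\Phi(y)$, and put $$C_{XX}=\int c_{xx}\,d\mu(x),\qquad C_{YX}=\int c_{yx}\,d\mu_{0,t}(x,y),\qquad c^0_{xx}=c_{xx}-C_{XX},\qquad c^0_{yx}=c_{yx}-C_{YX}.$$ Let $\|\cdot\|_{HS}$ denote the Hilbert-Schmidt norm and $\|\cdot\|_{L(H)}$ the operator norm. Suppose that there are real numbers $\sigma_t,\sigma_0,L\ge 0$ such that for all integers $n\ge 2$ $$\mathbb E^{\mu_{0,t}}\big[\|c^0_{yx}\|_{HS}^n\big]\le\tfrac12\,n!\,\sigma_t^2L^{n-2},\qquad \mathbb E^{\mu}\big[\|c^0_{xx}\|_{HS}^n\big]\le\tfrac12\,n!\,\sigma_0^2L^{n-2}.$$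 Let $\lambda>0$, $\delta>0$ and $m\ge 1$, let $(x_1,y_1),\dots,(x_m,y_m)$ be independent random pairs with law $\mu_{0,t}$, and put $$\hat C_{XX}=\frac1m\sum_{j=1}^m c_{x_jx_j},\quad \hat C_{YX}=\frac1m\sum_{j=1}^m c_{y_jx_j},\quad P=C_{YX}(C_{XX}+\lambda\,\mathrm{Id})^{-1},\quad \hat P=\hat C_{YX}(\hat C_{XX}+\lambda\,\mathrm{Id})^{-1}.$$ Then with probability at least $1-2\delta$ $$\|\hat P-P\|_{L(H)}\le\frac{2}{\lambda\sqrt m}\log\Big(\frac2\delta\Big)\left[\sigma_t+\frac{\|C_{YX}\|_{HS}}{\lambda}\,\sigma_0+\Big(1+\frac{\|C_{YX}\|_{HS}}{\lambda}\Big)\frac{L}{\sqrt m}\right].$$ -/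

import Mathlib

open MeasureTheory ProbabilityTheory
open scoped NNReal ENNReal Nat

namespace EmbeddedEvolution

noncomputable section

section HilbertSchmidt

variable {H : Type*} [NormedAddCommGroup H] [InnerProductSpace ℝ H] [CompleteSpace H]

/-- The index set of a chosen Hilbert basis of `H`. -/
def stdIndex (H : Type*) [NormedAddCommGroup H] [InnerProductSpace ℝ H] [CompleteSpace H] :
    Set H :=
  (exists_hilbertBasis ℝ H).choose

/-- A chosen Hilbert basis of `H`. -/
def stdBasis (H : Type*) [NormedAddCommGroup H] [InnerProductSpace ℝ H] [CompleteSpace H] :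
    HilbertBasis (stdIndex H) ℝ H :=
  (exists_hilbertBasis ℝ H).choose_spec.choose

/-- The Hilbert-Schmidt norm `(∑ᵢ ‖T eᵢ‖²)^(1/2)` of a bounded operator, with value `∞` if `T` is
not Hilbert-Schmidt. It does not depend on the Hilbert basis, see `hsNorm_eq`. -/
def hsNorm (T : H →L[ℝ] H) : ℝ≥0∞ :=
  (∑' i, ‖T (stdBasis H i)‖ₑ ^ 2) ^ (1 / 2 : ℝ)

set_option linter.unusedSectionVars false in
lemma enorm_sq_eq_tsum {ι : Type*} (b : HilbertBasis ι ℝ H) (x : H) :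
    ‖x‖ₑ ^ 2 = ∑' i, ENNReal.ofReal ((inner ℝ x (b i)) ^ 2) := by
  have h := b.hasSum_inner_mul_inner x x
  have h' : HasSum (fun i => (inner ℝ x (b i)) ^ 2) (‖x‖ ^ 2) := by
    rw [← real_inner_self_eq_norm_sq]
    convert! h using 2 with i
    rw [sq, real_inner_comm x (b i)]
  rw [← ENNReal.ofReal_tsum_of_nonneg (fun i => sq_nonneg _) h'.summable, h'.tsum_eq,
    ENNReal.ofReal_pow (norm_nonneg _), ofReal_norm]

lemma tsum_enorm_sq_adjoint {ι κ : Type*} (b : HilbertBasis ι ℝ H) (b' : HilbertBasis κ ℝ H)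
    (T : H →L[ℝ] H) :
    ∑' i, ‖T (b i)‖ₑ ^ 2 = ∑' j, ‖T.adjoint (b' j)‖ₑ ^ 2 := by
  have h1 : ∀ i, ‖T (b i)‖ₑ ^ 2 = ∑' j, ENNReal.ofReal ((inner ℝ (T (b i)) (b' j)) ^ 2) :=
    fun i => enorm_sq_eq_tsum b' _
  have h2 : ∀ j, ‖T.adjoint (b' j)‖ₑ ^ 2
      = ∑' i, ENNReal.ofReal ((inner ℝ (T.adjoint (b' j)) (b i)) ^ 2) :=
    fun j => enorm_sq_eq_tsum b _
  rw [tsum_congr h1, tsum_congr h2]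
  rw [ENNReal.tsum_comm]
  refine tsum_congr fun j => tsum_congr fun i => ?_
  rw [ContinuousLinearMap.adjoint_inner_left, real_inner_comm]

/-- The Hilbert-Schmidt norm may be computed in any Hilbert basis. -/
theorem hsNorm_eq {ι : Type*} (b : HilbertBasis ι ℝ H) (T : H →L[ℝ] H) :
    hsNorm T = (∑' i, ‖T (b i)‖ₑ ^ 2) ^ (1 / 2 : ℝ) := by
  rw [hsNorm, tsum_enorm_sq_adjoint (stdBasis H) b, ← tsum_enorm_sq_adjoint b b]

/-- The regularized operator `C_YX (C_XX + lam Id)⁻¹`. The inverse is a true inverse for every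
positive operator `C_XX` and every `lam > 0`, see `isUnit_add_smul_one`. -/
def regularized (CYX CXX : H →L[ℝ] H) (lam : ℝ) : H →L[ℝ] H :=
  CYX * Ring.inverse (CXX + lam • (1 : H →L[ℝ] H))

theorem isUnit_add_smul_one {A : H →L[ℝ] H} (hA : A.IsPositive) {lam : ℝ} (hlam : 0 < lam) :
    IsUnit (A + lam • (1 : H →L[ℝ] H)) := by
  refine ContinuousLinearMap.isUnit_of_forall_le_norm_inner_map _
    (c := ⟨lam, hlam.le⟩) hlam fun x => ?_
  have h : inner ℝ ((A + lam • (1 : H →L[ℝ] H)) x) x = inner ℝ (A x) x + lam * ‖x‖ ^ 2 := by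
    simp [inner_add_left, inner_smul_left]
  rw [h]
  refine le_trans ?_ (le_abs_self _)
  have h0 : 0 ≤ inner ℝ (A x) x := hA.inner_nonneg_left x
  change ‖x‖ ^ 2 * lam ≤ _
  linarith [mul_comm lam (‖x‖ ^ 2)]

end HilbertSchmidt

section Operators

variable {𝕏 : Type*} (H : Type*) [NormedAddCommGroup H] [InnerProductSpace ℝ H] [CompleteSpace H]
  [RKHS ℝ H 𝕏 ℝ]

/-- The reproducing kernel `k(x, y)` of the real reproducing kernel Hilbert space `H`. -/
def kern (x y : 𝕏) : ℝ := RKHS.kernel H x y 1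

/-- The feature map `Φ(x) = k(x, ·) ∈ H`. -/
def feature (x : 𝕏) : H := RKHS.kerFun H x 1

/-- The rank-one operator `c_{yx} = ⟨Φ(x), ·⟩ Φ(y)`. -/
def rankOneOp (y x : 𝕏) : H →L[ℝ] H :=
  InnerProductSpace.rankOne ℝ (feature H y) (feature H x)

/-- The covariance operator `C_XX = ∫ c_{xx} dμ(x)`. -/
def covXX [MeasurableSpace 𝕏] (μ : Measure 𝕏) : H →L[ℝ] H :=
  ∫ x, rankOneOp H x x ∂μ

/-- The cross-covariance operator `C_YX = ∫ c_{yx} dν(x, y)` of a joint law `ν` of `(x, y)`. -/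
def covYX [MeasurableSpace 𝕏] (ν : Measure (𝕏 × 𝕏)) : H →L[ℝ] H :=
  ∫ p, rankOneOp H p.2 p.1 ∂ν

/-- The empirical covariance operator `(1/m) ∑ₖ c_{xₖ xₖ}`. -/
def empCovXX {m : ℕ} (x : Fin m → 𝕏) : H →L[ℝ] H :=
  (1 / m : ℝ) • ∑ k, rankOneOp H (x k) (x k)

/-- The empirical cross-covariance operator `(1/m) ∑ₖ c_{yₖ xₖ}`. -/
def empCovYX {m : ℕ} (x y : Fin m → 𝕏) : H →L[ℝ] H :=
  (1 / m : ℝ) • ∑ k, rankOneOp H (y k) (x k)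

variable {H}

theorem covXX_isPositive [MeasurableSpace 𝕏] (μ : Measure 𝕏) : (covXX H μ).IsPositive := by
  by_cases hint : Integrable (fun x : 𝕏 => rankOneOp H x x) μ
  · have key : ∀ f g : H, inner ℝ (covXX H μ f) g
        = ∫ x, inner ℝ (rankOneOp H x x f) g ∂μ := by
      intro f g
      rw [covXX, ContinuousLinearMap.integral_apply hint, real_inner_comm,
        ← integral_inner (hint.apply_continuousLinearMap f)]
      simp_rw [real_inner_comm]
    rw [ContinuousLinearMap.isPositive_iff]
    refine ⟨fun f g => ?_, fun f => ?_⟩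
    · change inner ℝ (covXX H μ f) g = inner ℝ f (covXX H μ g)
      rw [real_inner_comm (covXX H μ g) f, key, key]
      refine integral_congr_ae (Filter.Eventually.of_forall fun x => ?_)
      simp only [rankOneOp, InnerProductSpace.rankOne_apply, inner_smul_left]
      simp [mul_comm]
    · rw [key]
      exact integral_nonneg fun x =>
        (InnerProductSpace.isPositive_rankOne_self (feature H x)).inner_nonneg_left f
  · rw [covXX, integral_undef hint]
    exact ContinuousLinearMap.isPositive_zero

theorem empCovXX_isPositive {m : ℕ} (x : Fin m → 𝕏) : (empCovXX H x).IsPositive := by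
  refine ContinuousLinearMap.IsPositive.smul_of_nonneg ?_ (by positivity)
  refine Finset.sum_induction _ ContinuousLinearMap.IsPositive (fun _ _ h h' => h.add h')
    ContinuousLinearMap.isPositive_zero fun k _ => ?_
  exact InnerProductSpace.isPositive_rankOne_self (feature H (x k))

end Operators

end

end EmbeddedEvolution

/-! Write A, B for the population covariance and cross-covariance, A', B' for their empirical
versions, R, R' for the inverses of A + λ and A' + λ. The resolvent identity gives B'R' - BR = (B' -
B)R' - B R (A' - A) R', and positivity bounds both inverses by 1/λ (`norm_regularized_sub_le`). It
remains to control two empirical means in operator norm, each outside an event of probability at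
most δ. The operator norm is at most the Hilbert-Schmidt norm, and the values of an operator on a
Hilbert basis turn the latter into the norm of an ℓ² space, which is a Hilbert space. There
Bernstein's inequality applies (`measure_pi_norm_sum_ge_le`). Its proof bounds the mean of cosh ‖s ∑
g(zₖ)‖: adding one centered sample costs a factor 1 + κ, because the first-order term of cosh ‖·‖
averages to zero. The moment bounds control κ, and Markov's inequality with an optimized s gives the
tail. -/

section Bernstein

/-! ### Bernstein's inequality in a Hilbert space -/

lemma cosh_add_le_and_cosh_sub_le {a r : ℝ} (ha : 0 ≤ a) (hr : 0 ≤ r) :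
    Real.cosh (a + r) ≤ Real.cosh a * (1 + (Real.exp r - 1 - r)) + Real.sinh a * r ∧
    Real.cosh (a - r) ≤ Real.cosh a * (1 + (Real.exp r - 1 - r)) - Real.sinh a * r := by
  have h1 : Real.sinh a ≤ Real.cosh a := (Real.sinh_lt_cosh a).le
  have h2 : r ≤ Real.sinh r := Real.self_le_sinh_iff.2 hr
  have h3 : 0 ≤ Real.sinh a := Real.sinh_nonneg_iff.2 ha
  have h4 := Real.cosh_add_sinh r
  rw [Real.cosh_add, Real.cosh_sub, ← h4]
  constructor
  · nlinarith [mul_le_mul_of_nonneg_right h1 (sub_nonneg.2 h2)]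
  · nlinarith [mul_le_mul_of_nonneg_right h1 (sub_nonneg.2 h2), mul_nonneg h3 (sub_nonneg.2 h2)]

/-- `u ↦ cosh √u` is convex on the nonnegative reals. -/
lemma cosh_le_of_sq_eq_add {b p q v w : ℝ} (hv : 0 ≤ v) (hw : 0 ≤ w) (hvw : v + w = 1)
    (hb : b ^ 2 = v * p ^ 2 + w * q ^ 2) :
    Real.cosh b ≤ v * Real.cosh p + w * Real.cosh q := by
  refine hasSum_le (fun n => ?_) (Real.hasSum_cosh b)
    (((Real.hasSum_cosh p).mul_left v).add ((Real.hasSum_cosh q).mul_left w))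
  have h := (convexOn_pow (𝕜 := ℝ) n).2 (Set.mem_Ici.2 (sq_nonneg p))
    (Set.mem_Ici.2 (sq_nonneg q)) hv hw hvw
  simp only [smul_eq_mul] at h
  rw [← hb] at h
  simp only [pow_mul]
  rw [← mul_div_assoc, ← mul_div_assoc, ← add_div]
  gcongr

variable {E : Type*} [NormedAddCommGroup E] [InnerProductSpace ℝ E]

/-- Second-order expansion of `cosh ‖·‖` in a real inner product space. -/
lemma cosh_norm_add_le (x y : E) :
    Real.cosh ‖x + y‖ ≤ Real.cosh ‖x‖ * (1 + (Real.exp ‖y‖ - 1 - ‖y‖))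
      + Real.sinh ‖x‖ / ‖x‖ * inner ℝ x y := by
  have hs : ‖x + y‖ ^ 2 = ‖x‖ ^ 2 + 2 * inner ℝ x y + ‖y‖ ^ 2 := norm_add_sq_real x y
  have hcs := abs_le.1 (abs_real_inner_le_norm x y)
  obtain ⟨h1, h2⟩ := cosh_add_le_and_cosh_sub_le (norm_nonneg x) (norm_nonneg y)
  -- Orthogonal case with equal weights; it also covers x = 0, where sinh ‖x‖ / ‖x‖ is 0 by
  -- convention.
  by_cases h0 : ‖x‖ * ‖y‖ = 0
  · have hi : (inner ℝ x y : ℝ) = 0 := by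
      rw [h0] at hcs; linarith
    have hb : ‖x + y‖ ^ 2 = (1 / 2) * (‖x‖ + ‖y‖) ^ 2 + (1 / 2) * (‖x‖ - ‖y‖) ^ 2 := by
      rw [hs, hi]; ring
    have := cosh_le_of_sq_eq_add (by norm_num) (by norm_num) (by norm_num) hb
    rw [hi]
    linarith
  · have hx : ‖x‖ ≠ 0 := left_ne_zero_of_mul h0
    have hpos : 0 < ‖x‖ * ‖y‖ := lt_of_le_of_ne (by positivity) (Ne.symm h0)
    -- With θ the cosine of the angle, ‖x + y‖² interpolates between the two collinear cases with
    -- weights (1 ± θ)/2, so convexity of cosh √u reduces to those cases.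
    set θ : ℝ := inner ℝ x y / (‖x‖ * ‖y‖) with hθ
    have hi : (inner ℝ x y : ℝ) = θ * (‖x‖ * ‖y‖) := (div_mul_cancel₀ _ h0).symm
    have hθ1 : θ ≤ 1 := (div_le_one hpos).2 hcs.2
    have hθ2 : -1 ≤ θ := by rw [hθ, le_div_iff₀ hpos]; linarith
    have hb : ‖x + y‖ ^ 2
        = ((1 + θ) / 2) * (‖x‖ + ‖y‖) ^ 2 + ((1 - θ) / 2) * (‖x‖ - ‖y‖) ^ 2 := by
      rw [hs, hi]; ring
    have hc := cosh_le_of_sq_eq_add (by linarith) (by linarith) (by ring) hb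
    have e : Real.sinh ‖x‖ / ‖x‖ * inner ℝ x y = θ * (Real.sinh ‖x‖ * ‖y‖) := by
      rw [hi]; field_simp
    rw [e]
    have g1 := mul_le_mul_of_nonneg_left h1 (show 0 ≤ (1 + θ) / 2 by linarith)
    have g2 := mul_le_mul_of_nonneg_left h2 (show 0 ≤ (1 - θ) / 2 by linarith)
    linarith

lemma exp_sub_one_sub_nonneg (r : ℝ) : 0 ≤ Real.exp r - 1 - r := by
  linarith [Real.add_one_le_exp r]

variable {Z : Type*} [MeasurableSpace Z] {ν : Measure Z} [IsProbabilityMeasure ν]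

/-- The inner product term is linear in g and has mean zero, so only the second-order remainder
survives. -/
lemma lintegral_cosh_norm_add_le [CompleteSpace E] {g : Z → E} (hg : Integrable g ν)
    (h0 : ∫ z, g z ∂ν = 0) {κ : ℝ} (hκ0 : 0 ≤ κ)
    (hκ : ∫⁻ z, ENNReal.ofReal (Real.exp ‖g z‖ - 1 - ‖g z‖) ∂ν ≤ ENNReal.ofReal κ) (a : E) :
    ∫⁻ z, ENNReal.ofReal (Real.cosh ‖a + g z‖) ∂ν
      ≤ ENNReal.ofReal (Real.cosh ‖a‖ * (1 + κ)) := by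
  have hm : AEStronglyMeasurable (fun z => Real.exp ‖g z‖ - 1 - ‖g z‖) ν := by
    have := hg.aestronglyMeasurable.norm
    exact ((Real.continuous_exp.comp_aestronglyMeasurable this).sub
      aestronglyMeasurable_const).sub this
  have hint : Integrable (fun z => Real.exp ‖g z‖ - 1 - ‖g z‖) ν := by
    refine (lintegral_ofReal_ne_top_iff_integrable hm
      (Filter.Eventually.of_forall fun z => exp_sub_one_sub_nonneg _)).1 ?_
    exact (hκ.trans_lt ENNReal.ofReal_lt_top).ne
  have hval : ∫ z, (Real.exp ‖g z‖ - 1 - ‖g z‖) ∂ν ≤ κ := by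
    rw [← ofReal_integral_eq_lintegral_ofReal hint
      (Filter.Eventually.of_forall fun z => exp_sub_one_sub_nonneg _)] at hκ
    exact (ENNReal.ofReal_le_ofReal_iff hκ0).1 hκ
  have hinner : Integrable (fun z => (inner ℝ a (g z) : ℝ)) ν := hg.const_inner a
  have hR : Integrable (fun z => Real.cosh ‖a‖ * (1 + (Real.exp ‖g z‖ - 1 - ‖g z‖))
      + Real.sinh ‖a‖ / ‖a‖ * inner ℝ a (g z)) ν :=
    (((integrable_const 1).add hint).const_mul _).add (hinner.const_mul _)
  calc ∫⁻ z, ENNReal.ofReal (Real.cosh ‖a + g z‖) ∂ν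
      ≤ ∫⁻ z, ENNReal.ofReal (Real.cosh ‖a‖ * (1 + (Real.exp ‖g z‖ - 1 - ‖g z‖))
          + Real.sinh ‖a‖ / ‖a‖ * inner ℝ a (g z)) ∂ν :=
        lintegral_mono fun z => ENNReal.ofReal_le_ofReal (cosh_norm_add_le _ _)
    _ = ENNReal.ofReal (∫ z, (Real.cosh ‖a‖ * (1 + (Real.exp ‖g z‖ - 1 - ‖g z‖))
          + Real.sinh ‖a‖ / ‖a‖ * inner ℝ a (g z)) ∂ν) := by
        refine (ofReal_integral_eq_lintegral_ofReal hR (Filter.Eventually.of_forall fun z => ?_)).symm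
        exact (Real.cosh_pos _).le.trans (cosh_norm_add_le _ _)
    _ ≤ _ := by
        refine ENNReal.ofReal_le_ofReal ?_
        have e1 : ∫ z, (1 + (Real.exp ‖g z‖ - 1 - ‖g z‖)) ∂ν
            = 1 + ∫ z, (Real.exp ‖g z‖ - 1 - ‖g z‖) ∂ν := by
          rw [integral_add (integrable_const 1) hint]; simp
        have hint1 : Integrable (fun z => 1 + (Real.exp ‖g z‖ - 1 - ‖g z‖)) ν :=
          (integrable_const 1).add hint
        rw [integral_add (hint1.const_mul _) (hinner.const_mul _),
          integral_const_mul, integral_const_mul, integral_inner hg, h0, inner_zero_right,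
          mul_zero, add_zero, e1]
        have := (Real.cosh_pos ‖a‖).le
        gcongr

/-- Induction on the number of samples. The start `a` is arbitrary because freezing the first sample
moves it to `a + g y`. -/
lemma lintegral_pi_cosh_norm_sum_le [CompleteSpace E] {g : Z → E} (hgm : StronglyMeasurable g)
    (hg : Integrable g ν) (h0 : ∫ z, g z ∂ν = 0) {κ : ℝ} (hκ0 : 0 ≤ κ)
    (hκ : ∫⁻ z, ENNReal.ofReal (Real.exp ‖g z‖ - 1 - ‖g z‖) ∂ν ≤ ENNReal.ofReal κ)
    (m : ℕ) (a : E) :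
    ∫⁻ z : Fin m → Z, ENNReal.ofReal (Real.cosh ‖a + ∑ k, g (z k)‖) ∂(Measure.pi fun _ => ν)
      ≤ ENNReal.ofReal (Real.cosh ‖a‖ * (1 + κ) ^ m) := by
  induction m generalizing a with
  | zero => simp
  | succ m ih =>
    have hmp := (measurePreserving_piFinSuccAbove (fun _ : Fin (m + 1) => ν) 0).symm
    have hsm : ∀ n : ℕ, StronglyMeasurable fun z : Fin n → Z => ∑ k, g (z k) := fun n => by
      refine Finset.stronglyMeasurable_fun_sum _ fun k _ => ?_
      exact hgm.comp_measurable (measurable_pi_apply k)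
    have hmeas : ∀ (n : ℕ), Measurable fun z : Fin n → Z =>
        ENNReal.ofReal (Real.cosh ‖a + ∑ k, g (z k)‖) := fun n =>
      (Real.continuous_cosh.comp_stronglyMeasurable
        (stronglyMeasurable_const.add (hsm n)).norm).measurable.ennreal_ofReal
    rw [← hmp.lintegral_comp (hmeas (m + 1)), lintegral_prod]
    swap
    · exact ((hmeas (m + 1)).comp hmp.measurable).aemeasurable
    calc _ = ∫⁻ y, ∫⁻ z : Fin m → Z, ENNReal.ofReal (Real.cosh ‖(a + g y) + ∑ k, g (z k)‖)
            ∂(Measure.pi fun _ => ν) ∂ν := by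
          refine lintegral_congr fun y => lintegral_congr fun z => ?_
          simp [MeasurableEquiv.piFinSuccAbove, Fin.sum_univ_succ, add_assoc]
      _ ≤ ∫⁻ y, ENNReal.ofReal (Real.cosh ‖a + g y‖ * (1 + κ) ^ m) ∂ν :=
          lintegral_mono fun y => ih _
      _ = (∫⁻ y, ENNReal.ofReal (Real.cosh ‖a + g y‖) ∂ν) * ENNReal.ofReal ((1 + κ) ^ m) := by
          rw [← lintegral_mul_const']
          · exact lintegral_congr fun y => ENNReal.ofReal_mul (Real.cosh_pos _).le
          · exact ENNReal.ofReal_ne_top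
      _ ≤ ENNReal.ofReal (Real.cosh ‖a‖ * (1 + κ)) * ENNReal.ofReal ((1 + κ) ^ m) := by
          gcongr
          exact lintegral_cosh_norm_add_le hg h0 hκ0 hκ a
      _ = _ := by
          rw [← ENNReal.ofReal_mul]
          · congr 1; ring
          · have := Real.cosh_pos ‖a‖; positivity

lemma hasSum_exp_sub_one_sub (r : ℝ) :
    HasSum (fun n : ℕ => r ^ (n + 2) / (n + 2)!) (Real.exp r - 1 - r) := by
  have h := NormedSpace.expSeries_div_hasSum_exp r
  rw [← Real.exp_eq_exp_ℝ, ← hasSum_nat_add_iff' 2] at h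
  simpa [Finset.sum_range_succ, sub_sub] using h

-- In the power series of exp r - 1 - r the factorials cancel those of the moment bounds, leaving a
-- geometric series of ratio sL.
omit [IsProbabilityMeasure ν] in
lemma lintegral_exp_sub_one_sub_le {g : Z → E} (hgm : StronglyMeasurable g) {σ L s : ℝ}
    (hL : 0 ≤ L) (hs : 0 ≤ s) (hsL : s * L < 1)
    (hmom : ∀ n : ℕ, 2 ≤ n →
      ∫⁻ z, ‖g z‖ₑ ^ n ∂ν ≤ ENNReal.ofReal (1 / 2 * n ! * σ ^ 2 * L ^ (n - 2))) :
    ∫⁻ z, ENNReal.ofReal (Real.exp ‖s • g z‖ - 1 - ‖s • g z‖) ∂ν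
      ≤ ENNReal.ofReal (s ^ 2 * σ ^ 2 / (2 * (1 - s * L))) := by
  have hterm : ∀ z, ENNReal.ofReal (Real.exp ‖s • g z‖ - 1 - ‖s • g z‖)
      = ∑' n : ℕ, ENNReal.ofReal (s ^ (n + 2) / (n + 2)!) * ‖g z‖ₑ ^ (n + 2) := fun z => by
    have h := hasSum_exp_sub_one_sub ‖s • g z‖
    rw [← h.tsum_eq, ENNReal.ofReal_tsum_of_nonneg (fun n => by positivity) h.summable]
    refine tsum_congr fun n => ?_
    rw [← ofReal_norm, ← ENNReal.ofReal_pow (norm_nonneg _), ← ENNReal.ofReal_mul (by positivity),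
      norm_smul, Real.norm_of_nonneg hs]
    congr 1; ring
  have hgeo : HasSum (fun n : ℕ => 1 / 2 * σ ^ 2 * s ^ 2 * (s * L) ^ n)
      (s ^ 2 * σ ^ 2 / (2 * (1 - s * L))) := by
    convert! (hasSum_geometric_of_lt_one (by positivity) hsL).mul_left (1 / 2 * σ ^ 2 * s ^ 2)
      using 1
    field_simp
  simp_rw [hterm]
  rw [lintegral_tsum fun n => ((hgm.enorm.pow_const _).const_mul _).aemeasurable, ← hgeo.tsum_eq,
    ENNReal.ofReal_tsum_of_nonneg (fun n => by positivity) hgeo.summable]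
  refine ENNReal.tsum_le_tsum fun n => ?_
  rw [lintegral_const_mul _ (hgm.enorm.pow_const _)]
  refine (mul_le_mul_right (hmom (n + 2) (by omega)) _).trans (le_of_eq ?_)
  rw [← ENNReal.ofReal_mul (by positivity)]
  congr 1
  have : ((n + 2)! : ℝ) ≠ 0 := by positivity
  simp only [Nat.add_sub_cancel]
  field_simp
  ring

/-- Bernstein's inequality in a Hilbert space (Pinelis and Sakhanenko), tail form. -/
theorem measure_pi_norm_sum_ge_le [CompleteSpace E] {g : Z → E} (hgm : StronglyMeasurable g)
    (hg : Integrable g ν) (h0 : ∫ z, g z ∂ν = 0) {σ L : ℝ} (hσ : 0 < σ) (hL : 0 ≤ L)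
    (hmom : ∀ n : ℕ, 2 ≤ n →
      ∫⁻ z, ‖g z‖ₑ ^ n ∂ν ≤ ENNReal.ofReal (1 / 2 * n ! * σ ^ 2 * L ^ (n - 2)))
    {m : ℕ} (hm : 1 ≤ m) {r : ℝ} (hr : 0 ≤ r) :
    (Measure.pi fun _ : Fin m => ν) {z | r ≤ ‖∑ k, g (z k)‖}
      ≤ ENNReal.ofReal (2 * Real.exp (-(r ^ 2 / (2 * (m * σ ^ 2 + r * L))))) := by
  have hm0 : (0 : ℝ) < m := by exact_mod_cast hm
  have hD : 0 < m * σ ^ 2 + r * L := by positivity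
  set D := m * σ ^ 2 + r * L with hDdef
  -- This choice makes 1 - sL = mσ²/D, hence mκ = r²/(2D), and the final exponent mκ - sr equals
  -- -r²/(2D).
  set s := r / D with hsdef
  have hs : 0 ≤ s := by positivity
  have hsL' : 1 - s * L = m * σ ^ 2 / D := by rw [hsdef]; field_simp; rw [hDdef]; ring
  have hsL : s * L < 1 := by
    have : 0 < m * σ ^ 2 / D := by positivity
    linarith
  set κ := s ^ 2 * σ ^ 2 / (2 * (1 - s * L)) with hκdef
  have hκ0 : 0 ≤ κ := by rw [hκdef, hsL']; positivity
  have hκe : m * κ = r ^ 2 / (2 * D) := by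
    rw [hκdef, hsL', hsdef]; field_simp
  have hE := lintegral_pi_cosh_norm_sum_le (hgm.const_smul s) (hg.smul s)
    (by simp [integral_smul, h0]) hκ0 (lintegral_exp_sub_one_sub_le hgm hL hs hsL hmom) m 0
  simp only [zero_add, norm_zero, Real.cosh_zero, one_mul, Pi.smul_apply] at hE
  have hmk := mul_meas_ge_le_lintegral₀ (μ := Measure.pi fun _ : Fin m => ν)
    (f := fun z : Fin m → Z => ENNReal.ofReal (Real.cosh ‖∑ k, s • g (z k)‖)) (by
      refine (Real.continuous_cosh.comp_stronglyMeasurable (StronglyMeasurable.norm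
        ?_)).measurable.ennreal_ofReal.aemeasurable
      refine Finset.stronglyMeasurable_fun_sum _ fun k _ => ?_
      exact (hgm.const_smul s).comp_measurable (measurable_pi_apply k))
    (ENNReal.ofReal (Real.exp (s * r) / 2))
  have hsub : {z : Fin m → Z | r ≤ ‖∑ k, g (z k)‖} ⊆ {z | ENNReal.ofReal (Real.exp (s * r) / 2)
      ≤ ENNReal.ofReal (Real.cosh ‖∑ k, s • g (z k)‖)} := fun z hz => by
    refine ENNReal.ofReal_le_ofReal ?_
    rw [← Finset.smul_sum, norm_smul, Real.norm_of_nonneg hs, Real.cosh_eq]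
    have h1 := Real.exp_pos (-(s * ‖∑ k, g (z k)‖))
    have h2 : Real.exp (s * r) ≤ Real.exp (s * ‖∑ k, g (z k)‖) := by
      have : r ≤ ‖∑ k, g (z k)‖ := hz
      gcongr
    linarith
  have hpos : 0 < Real.exp (s * r) / 2 := by positivity
  have h3 := (mul_le_mul_right (measure_mono hsub) _).trans (hmk.trans hE)
  rw [mul_comm, ← ENNReal.le_div_iff_mul_le (Or.inl (by simpa using hpos)) (Or.inl (by simp)),
    ← ENNReal.ofReal_div_of_pos hpos] at h3
  refine h3.trans (ENNReal.ofReal_le_ofReal ?_)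
  have h4 : (1 + κ) ^ m ≤ Real.exp (m * κ) := by
    rw [Real.exp_nat_mul]
    exact pow_le_pow_left₀ (by linarith) (by linarith [Real.add_one_le_exp κ]) m
  rw [div_le_iff₀ hpos]
  refine h4.trans (le_of_eq ?_)
  rw [show ∀ x y : ℝ, 2 * x * (y / 2) = x * y from fun x y => by ring, ← Real.exp_add, hκe]
  congr 1
  rw [hsdef]; field_simp; ring

/-- Bernstein's inequality in a Hilbert space, confidence form. -/
theorem measure_pi_norm_sum_gt_le [CompleteSpace E] {g : Z → E} (hgm : StronglyMeasurable g)
    (hg : Integrable g ν) (h0 : ∫ z, g z ∂ν = 0) {σ L : ℝ} (hσ : 0 ≤ σ) (hL : 0 ≤ L)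
    (hmom : ∀ n : ℕ, 2 ≤ n →
      ∫⁻ z, ‖g z‖ₑ ^ n ∂ν ≤ ENNReal.ofReal (1 / 2 * n ! * σ ^ 2 * L ^ (n - 2)))
    {m : ℕ} (hm : 1 ≤ m) {δ : ℝ} (hδ : 0 < δ) (hδ1 : δ < 1 / 2) :
    (Measure.pi fun _ : Fin m => ν)
      {z | 2 / √m * Real.log (2 / δ) * (σ + L / √m) < ‖(1 / m : ℝ) • ∑ k, g (z k)‖}
      ≤ ENNReal.ofReal δ := by
  have hm0 : (0 : ℝ) < m := by exact_mod_cast hm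
  -- Since log 2 > 1/2, this gives 2ℓ ≥ 1, which is what makes qσ ≤ r below.
  have hl : 1 / 2 ≤ Real.log (2 / δ) := by
    have h4 : (2 : ℝ) ≤ 2 / δ := by rw [le_div_iff₀ hδ]; linarith
    have := Real.log_le_log (by norm_num) h4
    linarith [Real.log_two_gt_d9]
  set ℓ := Real.log (2 / δ) with hℓ
  -- The tail form needs σ > 0. If σ = 0, the second moment vanishes and g is zero almost
  -- everywhere.
  rcases hσ.eq_or_lt with rfl | hσ
  · have h2 := hmom 2 le_rfl
    have hae : ∀ᵐ z ∂ν, g z = 0 := by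
      have h3 : ∫⁻ z, ‖g z‖ₑ ^ 2 ∂ν = 0 := by simpa using h2
      rw [lintegral_eq_zero_iff (hgm.enorm.pow_const 2)] at h3
      filter_upwards [h3] with z hz
      simpa using hz
    have hall : ∀ᵐ z ∂(Measure.pi fun _ : Fin m => ν), ∀ k, g (z k) = 0 :=
      ae_all_iff.2 fun k => (Measure.quasiMeasurePreserving_eval (fun _ => ν) k).ae hae
    refine le_of_eq_of_le (measure_mono_null ?_ (ae_iff.1 hall)) zero_le
    intro z hz hz0
    simp only [Set.mem_ofPred_eq, hz0, Finset.sum_const_zero, smul_zero, norm_zero] at hz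
    have : 0 ≤ 2 / √m * ℓ * (0 + L / √m) := by positivity
    linarith
  · set q := √(m : ℝ) with hq
    have hq0 : 0 < q := Real.sqrt_pos.2 hm0
    have hqq : q ^ 2 = m := Real.sq_sqrt hm0.le
    set r := 2 * ℓ * (q * σ + L) with hrdef
    have hr : 0 ≤ r := by positivity
    have hsub : {z : Fin m → Z | 2 / q * ℓ * (σ + L / q) < ‖(1 / m : ℝ) • ∑ k, g (z k)‖}
        ⊆ {z | r ≤ ‖∑ k, g (z k)‖} := fun z hz => by
      simp only [Set.mem_ofPred_eq, norm_smul] at hz ⊢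
      rw [Real.norm_of_nonneg (by positivity), one_div, ← div_eq_inv_mul, lt_div_iff₀ hm0,
        ← hqq] at hz
      refine le_of_eq_of_le ?_ hz.le
      rw [hrdef]; field_simp
    refine (measure_mono hsub).trans
      ((measure_pi_norm_sum_ge_le hgm hg h0 hσ hL hmom hm hr).trans
        (ENNReal.ofReal_le_ofReal ?_))
    have hD : 0 < 2 * (m * σ ^ 2 + r * L) := by positivity
    -- By definition r² = 2ℓ(r·qσ + rL), and qσ ≤ r turns r·qσ into at least q²σ² = mσ².
    have hexp : ℓ ≤ r ^ 2 / (2 * (m * σ ^ 2 + r * L)) := by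
      rw [le_div_iff₀ hD, ← hqq]
      have hge : q * σ ≤ r := by
        rw [hrdef]
        nlinarith [mul_pos hq0 hσ]
      have h5 := mul_le_mul_of_nonneg_right hge (show 0 ≤ q * σ by positivity)
      have : r ^ 2 = 2 * ℓ * (r * (q * σ) + r * L) := by rw [hrdef]; ring
      rw [this]
      have hℓ0 : 0 ≤ 2 * ℓ := by linarith
      nlinarith [mul_le_mul_of_nonneg_left h5 hℓ0]
    calc 2 * Real.exp (-(r ^ 2 / (2 * (m * σ ^ 2 + r * L)))) ≤ 2 * Real.exp (-ℓ) := by gcongr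
      _ = δ := by
        rw [Real.exp_neg, hℓ, Real.exp_log (by positivity)]; field_simp

/-- Bernstein's inequality for the mean of independent samples of a common law. -/
theorem measure_norm_mean_gt_le [CompleteSpace E] {g : Z → E} (hgm : StronglyMeasurable g)
    (hg : Integrable g ν) (h0 : ∫ z, g z ∂ν = 0) {σ L : ℝ} (hσ : 0 ≤ σ) (hL : 0 ≤ L)
    (hmom : ∀ n : ℕ, 2 ≤ n →
      ∫⁻ z, ‖g z‖ₑ ^ n ∂ν ≤ ENNReal.ofReal (1 / 2 * n ! * σ ^ 2 * L ^ (n - 2)))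
    {m : ℕ} (hm : 1 ≤ m) {δ : ℝ} (hδ : 0 < δ) (hδ1 : δ < 1 / 2)
    {Ω : Type*} [MeasurableSpace Ω] {P : Measure Ω} [IsProbabilityMeasure P]
    {W : Fin m → Ω → Z} (hW : ∀ k, Measurable (W k)) (hindep : iIndepFun W P)
    (hlaw : ∀ k, P.map (W k) = ν) :
    P {ω | 2 / √m * Real.log (2 / δ) * (σ + L / √m) < ‖(1 / m : ℝ) • ∑ k, g (W k ω)‖}
      ≤ ENNReal.ofReal δ := by
  have h := (iIndepFun_iff_map_fun_eq_pi_map fun k => (hW k).aemeasurable).1 hindep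
  simp only [hlaw] at h
  refine le_trans (le_of_eq ?_) (measure_pi_norm_sum_gt_le hgm hg h0 hσ hL hmom hm hδ hδ1)
  rw [← h, Measure.map_apply (measurable_pi_lambda _ hW)]
  · rfl
  · refine measurableSet_lt measurable_const (StronglyMeasurable.norm ?_).measurable
    refine StronglyMeasurable.const_smul (Finset.stronglyMeasurable_fun_sum _ fun k _ => ?_) _
    exact hgm.comp_measurable (measurable_pi_apply k)

end Bernstein

namespace EmbeddedEvolution

/-! ### Hilbert-Schmidt norm, its ℓ² model, and perturbation of the regularized operator -/

section HilbertSchmidtNorm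

variable {H : Type*} [NormedAddCommGroup H] [InnerProductSpace ℝ H] [CompleteSpace H]

lemma hsNorm_sq {ι : Type*} (b : HilbertBasis ι ℝ H) (T : H →L[ℝ] H) :
    hsNorm T ^ 2 = ∑' i, ‖T (b i)‖ₑ ^ 2 := by
  rw [hsNorm_eq b, ← ENNReal.rpow_natCast, ← ENNReal.rpow_mul]
  norm_num

/-- Any unit vector u extends to a Hilbert basis, and the norm is basis independent, so ‖T u‖² is
one term of the defining sum. -/
lemma enorm_le_hsNorm (T : H →L[ℝ] H) : ‖T‖ₑ ≤ hsNorm T := by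
  by_cases htop : hsNorm T = ⊤
  · rw [htop]; exact le_top
  have hunit : ∀ u : H, ‖u‖ = 1 → ‖T u‖ ≤ (hsNorm T).toReal := fun u hu => by
    have ho : Orthonormal ℝ ((↑) : ({u} : Set H) → H) := by
      refine ⟨fun i => ?_, fun i j hij => (hij (Subsingleton.elim i j)).elim⟩
      rw [i.2]; exact hu
    obtain ⟨w, b, hw, hb⟩ := ho.exists_hilbertBasis_extension
    have h := ENNReal.le_tsum (f := fun i => ‖T (b i)‖ₑ ^ 2) ⟨u, hw rfl⟩
    rw [← hsNorm_sq b, hb] at h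
    have h2 : ‖T u‖ₑ ≤ hsNorm T := (ENNReal.pow_right_strictMono two_ne_zero).le_iff_le.1 h
    rw [← ofReal_norm] at h2
    exact (ENNReal.ofReal_le_iff_le_toReal htop).1 h2
  rw [← ofReal_norm, ENNReal.ofReal_le_iff_le_toReal htop]
  refine T.opNorm_le_bound ENNReal.toReal_nonneg fun x => ?_
  rcases eq_or_ne x 0 with rfl | hx
  · simp
  have h := hunit (‖x‖⁻¹ • x) (norm_smul_inv_norm hx)
  rwa [map_smul, norm_smul, norm_inv, norm_norm, inv_mul_le_iff₀ (norm_pos_iff.2 hx),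
    mul_comm] at h

/-- Bridge to a genuine Hilbert space; it also yields finiteness of `hsNorm T` at once. -/
lemma hsNorm_eq_enorm_lp {ι : Type*} (b : HilbertBasis ι ℝ H) {T : H →L[ℝ] H}
    {w : lp (fun _ : ι => H) 2} (h : ∀ i, T (b i) = w i) : hsNorm T = ‖w‖ₑ := by
  refine (ENNReal.pow_right_strictMono two_ne_zero).injective ?_
  have hs := lp.hasSum_norm (p := 2) (by norm_num) w
  simp only [ENNReal.toReal_ofNat, Real.rpow_ofNat] at hs
  change hsNorm T ^ 2 = ‖w‖ₑ ^ 2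
  rw [hsNorm_sq b, ← ofReal_norm, ← ENNReal.ofReal_pow (norm_nonneg _), ← hs.tsum_eq,
    ENNReal.ofReal_tsum_of_nonneg (fun i => by positivity) hs.summable]
  refine tsum_congr fun i => ?_
  rw [h, ← ofReal_norm, ← ENNReal.ofReal_pow (norm_nonneg _)]

lemma hsNorm_rankOne (u v : H) : hsNorm (InnerProductSpace.rankOne ℝ v u) = ‖u‖ₑ * ‖v‖ₑ := by
  refine (ENNReal.pow_right_strictMono two_ne_zero).injective ?_
  rw [hsNorm_sq (stdBasis H), mul_pow, enorm_sq_eq_tsum (stdBasis H) u, ← ENNReal.tsum_mul_right]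
  refine tsum_congr fun i => ?_
  rw [InnerProductSpace.rankOne_apply, enorm_smul, mul_pow, ← ofReal_norm,
    ← ENNReal.ofReal_pow (norm_nonneg _), Real.norm_eq_abs, sq_abs]

omit [CompleteSpace H] in
lemma memℓp_inner_smul {ι : Type*} (b : HilbertBasis ι ℝ H) (u v : H) :
    Memℓp (fun i => (inner ℝ u (b i) : ℝ) • v) 2 := by
  refine memℓp_gen ?_
  have h := (lp.hasSum_norm (p := 2) (by norm_num) (b.repr u)).summable.mul_right (‖v‖ ^ 2)
  refine h.congr fun i => ?_
  rw [b.repr_apply_apply, real_inner_comm, norm_smul]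
  simp [mul_pow]

/-- The operator `⟨u, ·⟩ v` as the square summable family of its values at the Hilbert basis. -/
noncomputable def rankOneLp {ι : Type*} (b : HilbertBasis ι ℝ H) :
    H →L[ℝ] H →L[ℝ] lp (fun _ : ι => H) 2 :=
  LinearMap.mkContinuous₂
    (LinearMap.mk₂ ℝ (fun u v => (⟨_, memℓp_inner_smul b u v⟩ : lp (fun _ : ι => H) 2))
      (fun u u' v => by ext i; simp [inner_add_left, add_smul]; rfl)
      (fun c u v => by ext i; simp [inner_smul_left, mul_smul])
      (fun u v v' => by ext i; simp; rfl)
      (fun c u v => by ext i; simp [smul_comm c])) 1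
    (fun u v => by
      have h : hsNorm (InnerProductSpace.rankOne ℝ v u)
          = ‖(⟨_, memℓp_inner_smul b u v⟩ : lp (fun _ : ι => H) 2)‖ₑ :=
        hsNorm_eq_enorm_lp b fun i => rfl
      rw [hsNorm_rankOne] at h
      have h' := congrArg ENNReal.toReal h
      simp only [ENNReal.toReal_mul, toReal_enorm] at h'
      rw [one_mul, h']
      rfl)

lemma rankOneLp_apply {ι : Type*} (b : HilbertBasis ι ℝ H) (u v : H) (i : ι) :
    rankOneLp b u v i = InnerProductSpace.rankOne ℝ v u (b i) := rfl

/-- Pairing (A + λ)x = y with x and dropping ⟨Ax, x⟩ ≥ 0 leaves λ‖x‖² ≤ ‖y‖‖x‖. -/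
lemma norm_inverse_add_smul_one_le {A : H →L[ℝ] H} (hA : A.IsPositive) {lam : ℝ}
    (hlam : 0 < lam) : ‖Ring.inverse (A + lam • (1 : H →L[ℝ] H))‖ ≤ lam⁻¹ := by
  refine ContinuousLinearMap.opNorm_le_bound _ (by positivity) fun y => ?_
  set x := Ring.inverse (A + lam • (1 : H →L[ℝ] H)) y with hx
  have hy : A x + lam • x = y := by
    have h := congrArg (fun T : H →L[ℝ] H => T y)
      (Ring.mul_inverse_cancel _ (isUnit_add_smul_one hA hlam))
    simpa using h
  have h0 : 0 ≤ inner ℝ (A x) x := hA.inner_nonneg_left x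
  have h1 : lam * ‖x‖ ^ 2 ≤ ‖y‖ * ‖x‖ := by
    refine le_trans ?_ (real_inner_le_norm y x)
    rw [← hy, inner_add_left, real_inner_smul_left, real_inner_self_eq_norm_sq]
    linarith
  rw [le_inv_mul_iff₀ hlam]
  rcases (norm_nonneg x).eq_or_lt with h | h
  · rw [← h]; simp
  · exact le_of_mul_le_mul_right (by linarith [sq ‖x‖]) h

/-- Perturbation bound for the regularized operator. -/
lemma norm_regularized_sub_le {A A' : H →L[ℝ] H} (hA : A.IsPositive) (hA' : A'.IsPositive)
    (B B' : H →L[ℝ] H) {lam : ℝ} (hlam : 0 < lam) :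
    ‖regularized B' A' lam - regularized B A lam‖
      ≤ ‖B' - B‖ / lam + ‖B‖ / lam * (‖A' - A‖ / lam) := by
  have hu := isUnit_add_smul_one hA hlam
  have hu' := isUnit_add_smul_one hA' hlam
  have hn := norm_inverse_add_smul_one_le hA hlam
  have hn' := norm_inverse_add_smul_one_le hA' hlam
  -- This splitting keeps the deterministic B, not the random B', in the second term.
  have e : regularized B' A' lam - regularized B A lam
      = (B' - B) * Ring.inverse (A' + lam • (1 : H →L[ℝ] H))
        - B * (Ring.inverse (A + lam • (1 : H →L[ℝ] H)) * (A' - A)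
          * Ring.inverse (A' + lam • (1 : H →L[ℝ] H))) := by
    have h := Ring.inverse_sub_inverse (iff_of_true hu hu')
    rw [add_sub_add_right_eq_sub] at h
    rw [← h, regularized, regularized]
    noncomm_ring
  rw [e]
  refine (norm_sub_le _ _).trans (add_le_add ?_ ?_)
  · rw [div_eq_mul_inv]
    exact (norm_mul_le _ _).trans (by gcongr)
  · calc _ ≤ ‖B‖ * (lam⁻¹ * ‖A' - A‖ * lam⁻¹) := by
          refine (norm_mul_le _ _).trans ?_
          gcongr
          refine (norm_mul_le _ _).trans ?_
          gcongr
          refine (norm_mul_le _ _).trans ?_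
          gcongr
      _ = _ := by field_simp

end HilbertSchmidtNorm

/-! ### Random rank-one operators and their means -/

section RandomRankOne

variable {H : Type*} [NormedAddCommGroup H] [InnerProductSpace ℝ H] [CompleteSpace H]
  {Z : Type*} [MeasurableSpace Z] {ν : Measure Z}
  {u v : Z → H}

omit [CompleteSpace H] in
lemma stronglyMeasurable_rankOne (hu : StronglyMeasurable u) (hv : StronglyMeasurable v) :
    StronglyMeasurable fun z => InnerProductSpace.rankOne ℝ (v z) (u z) :=
  (InnerProductSpace.rankOne ℝ (E := H) (F := H)).continuous₂.comp_stronglyMeasurable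
    (f := fun z => (v z, u z)) (hv.prodMk hu)

lemma stronglyMeasurable_rankOneLp {ι : Type*} (b : HilbertBasis ι ℝ H)
    (hu : StronglyMeasurable u) (hv : StronglyMeasurable v) :
    StronglyMeasurable fun z => rankOneLp b (u z) (v z) :=
  (rankOneLp b).continuous₂.comp_stronglyMeasurable (hu.prodMk hv)

/-- Operator and Hilbert-Schmidt norms agree in rank one, so integrability passes to the ℓ² model.
-/
lemma norm_rankOneLp {ι : Type*} (b : HilbertBasis ι ℝ H) (u v : H) :
    ‖rankOneLp b u v‖ = ‖InnerProductSpace.rankOne ℝ v u‖ := by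
  have h := hsNorm_eq_enorm_lp b (T := InnerProductSpace.rankOne ℝ v u)
    (w := rankOneLp b u v) fun i => rfl
  rw [hsNorm_rankOne] at h
  have h' := congrArg ENNReal.toReal h
  simp only [ENNReal.toReal_mul, toReal_enorm] at h'
  rw [← h', InnerProductSpace.norm_rankOne, mul_comm]

/-- Without integrability the Bochner integral would be 0, so the centered moment would be an
uncentered one; its finiteness gives L², hence L¹, a contradiction. -/
lemma integrable_rankOne_of_lintegral_hsNorm [IsFiniteMeasure ν]
    (hu : StronglyMeasurable u) (hv : StronglyMeasurable v)
    (h : ∫⁻ z, hsNorm (InnerProductSpace.rankOne ℝ (v z) (u z)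
      - ∫ z, InnerProductSpace.rankOne ℝ (v z) (u z) ∂ν) ^ 2 ∂ν < ⊤) :
    Integrable (fun z => InnerProductSpace.rankOne ℝ (v z) (u z)) ν := by
  by_contra hn
  rw [integral_undef hn] at h
  refine hn (MemLp.integrable (q := 2) (by norm_num)
    ⟨(stronglyMeasurable_rankOne hu hv).aestronglyMeasurable, ?_⟩)
  rw [eLpNorm_lt_top_iff_lintegral_rpow_enorm_lt_top (by norm_num) (by norm_num)]
  refine lt_of_le_of_lt (lintegral_mono fun z => ?_) h
  simp only [ENNReal.toReal_ofNat, ENNReal.rpow_ofNat, sub_zero]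
  gcongr
  exact enorm_le_hsNorm _

/-- Evaluating an operator at a basis vector and taking an ℓ² coordinate are bounded linear maps, so
both commute with the integral. -/
lemma integral_rankOne_apply {ι : Type*} (b : HilbertBasis ι ℝ H)
    (hc : Integrable (fun z => InnerProductSpace.rankOne ℝ (v z) (u z)) ν)
    (hB : Integrable (fun z => rankOneLp b (u z) (v z)) ν) (i : ι) :
    (∫ z, InnerProductSpace.rankOne ℝ (v z) (u z) ∂ν) (b i)
      = (∫ z, rankOneLp b (u z) (v z) ∂ν : lp (fun _ : ι => H) 2) i := by
  have h := (lp.evalCLM ℝ (fun _ : ι => H) (p := 2) i).integral_comp_comm hB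
  rw [ContinuousLinearMap.integral_apply hc]
  exact h

/-- As `toReal` sends ∞ to 0, finiteness is needed; the ℓ² mean provides it. -/
lemma norm_le_toReal_hsNorm_integral [IsProbabilityMeasure ν]
    (hu : StronglyMeasurable u) (hv : StronglyMeasurable v)
    (hc : Integrable (fun z => InnerProductSpace.rankOne ℝ (v z) (u z)) ν) :
    ‖∫ z, InnerProductSpace.rankOne ℝ (v z) (u z) ∂ν‖
      ≤ (hsNorm (∫ z, InnerProductSpace.rankOne ℝ (v z) (u z) ∂ν)).toReal := by
  have hB : Integrable (fun z => rankOneLp (stdBasis H) (u z) (v z)) ν :=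
    hc.congr' (stronglyMeasurable_rankOneLp _ hu hv).aestronglyMeasurable
      (Filter.Eventually.of_forall fun z => (norm_rankOneLp _ _ _).symm)
  have h := hsNorm_eq_enorm_lp _ (integral_rankOne_apply (stdBasis H) hc hB)
  rw [← toReal_enorm]
  refine ENNReal.toReal_mono ?_ (enorm_le_hsNorm _)
  rw [h]; exact enorm_ne_top

/-- Concentration of the empirical mean of random rank-one operators in operator norm. -/
theorem measure_norm_mean_rankOne_gt_le [IsProbabilityMeasure ν]
    (hu : StronglyMeasurable u) (hv : StronglyMeasurable v)
    (hc : Integrable (fun z => InnerProductSpace.rankOne ℝ (v z) (u z)) ν)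
    {σ L : ℝ} (hσ : 0 ≤ σ) (hL : 0 ≤ L)
    (hmom : ∀ n : ℕ, 2 ≤ n →
      ∫⁻ z, hsNorm (InnerProductSpace.rankOne ℝ (v z) (u z)
        - ∫ z, InnerProductSpace.rankOne ℝ (v z) (u z) ∂ν) ^ n ∂ν
        ≤ ENNReal.ofReal (1 / 2 * n ! * σ ^ 2 * L ^ (n - 2)))
    {m : ℕ} (hm : 1 ≤ m) {δ : ℝ} (hδ : 0 < δ) (hδ1 : δ < 1 / 2)
    {Ω : Type*} [MeasurableSpace Ω] {P : Measure Ω} [IsProbabilityMeasure P]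
    {W : Fin m → Ω → Z} (hW : ∀ k, Measurable (W k)) (hindep : iIndepFun W P)
    (hlaw : ∀ k, P.map (W k) = ν) :
    P {ω | 2 / √m * Real.log (2 / δ) * (σ + L / √m)
        < ‖(1 / m : ℝ) • ∑ k, InnerProductSpace.rankOne ℝ (v (W k ω)) (u (W k ω))
          - ∫ z, InnerProductSpace.rankOne ℝ (v z) (u z) ∂ν‖}
      ≤ ENNReal.ofReal δ := by
  have hm0 : (m : ℝ) ≠ 0 := by exact_mod_cast (by omega : m ≠ 0)
  have hBm := stronglyMeasurable_rankOneLp (stdBasis H) hu hv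
  have hB : Integrable (fun z => rankOneLp (stdBasis H) (u z) (v z)) ν :=
    hc.congr' hBm.aestronglyMeasurable
      (Filter.Eventually.of_forall fun z => (norm_rankOneLp _ _ _).symm)
  have hI := integral_rankOne_apply (stdBasis H) hc hB
  set M := ∫ z, rankOneLp (stdBasis H) (u z) (v z) ∂ν with hM
  set C := ∫ z, InnerProductSpace.rankOne ℝ (v z) (u z) ∂ν with hC
  have hg0 : ∫ z, (rankOneLp (stdBasis H) (u z) (v z) - M) ∂ν = 0 := by
    rw [integral_sub hB (integrable_const M)]; simp [hM]
  refine le_trans (measure_mono fun ω hω => ?_) (measure_norm_mean_gt_le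
    (g := fun z => rankOneLp (stdBasis H) (u z) (v z) - M)
    (hBm.sub stronglyMeasurable_const) (hB.sub (integrable_const M)) hg0 hσ hL ?_ hm hδ hδ1
    hW hindep hlaw)
  · refine lt_of_lt_of_le (Set.mem_ofPred_eq ▸ hω) ?_
    have h : hsNorm ((1 / m : ℝ) • ∑ k, InnerProductSpace.rankOne ℝ (v (W k ω)) (u (W k ω)) - C)
        = ‖(1 / m : ℝ) • ∑ k, (rankOneLp (stdBasis H) (u (W k ω)) (v (W k ω)) - M)‖ₑ := by
      refine hsNorm_eq_enorm_lp (stdBasis H) fun i => ?_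
      rw [Finset.sum_sub_distrib, smul_sub, Finset.sum_const, Finset.card_univ, Fintype.card_fin,
        ← Nat.cast_smul_eq_nsmul ℝ, smul_smul, one_div, inv_mul_cancel₀ hm0, one_smul]
      simp only [_root_.sub_apply, _root_.smul_apply,
        _root_.sum_apply, lp.coeFn_sub, lp.coeFn_smul, lp.coeFn_sum, Pi.sub_apply,
        Pi.smul_apply, Finset.sum_apply, hI, rankOneLp_apply]
    rw [← toReal_enorm, ← toReal_enorm (_ • _), ← h]
    exact ENNReal.toReal_mono (h ▸ enorm_ne_top) (enorm_le_hsNorm _)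
  · intro n hn
    refine le_of_eq_of_le (lintegral_congr fun z => ?_) (hmom n hn)
    congr 1
    refine (hsNorm_eq_enorm_lp (stdBasis H) fun i => ?_).symm
    simp only [_root_.sub_apply, lp.coeFn_sub, Pi.sub_apply, hI, rankOneLp_apply]

end RandomRankOne

/-! ### Measurability of the feature map -/

section Feature

variable {𝕏 : Type*} [MeasurableSpace 𝕏] {H : Type*} [NormedAddCommGroup H]
  [InnerProductSpace ℝ H] [CompleteSpace H] [RKHS ℝ H 𝕏 ℝ]

omit [MeasurableSpace 𝕏] in
lemma inner_feature (f : H) (x : 𝕏) : inner ℝ f (feature H x) = f x := by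
  simp [feature]

/-- Kernel sections span a dense subspace, and norm limits in H are pointwise limits. -/
lemma measurable_coe (hkern : Measurable fun p : 𝕏 × 𝕏 => kern H p.1 p.2) (f : H) :
    Measurable (f : 𝕏 → ℝ) := by
  have hf : f ∈ (Submodule.span ℝ {RKHS.kerFun H x v | (x : 𝕏) (v : ℝ)}).topologicalClosure := by
    rw [RKHS.kerFun_dense]; trivial
  have hspan : ∀ g ∈ Submodule.span ℝ {RKHS.kerFun H x v | (x : 𝕏) (v : ℝ)},
      Measurable (g : 𝕏 → ℝ) := fun g hg => by
    induction hg using Submodule.span_induction with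
    | mem g hg =>
      obtain ⟨y, c, rfl⟩ := hg
      have h : ⇑(RKHS.kerFun H y c) = fun x => c * kern H x y := by
        ext x
        rw [RKHS.kerFun_apply, kern, ← smul_eq_mul, ← map_smul, smul_eq_mul, mul_one]
      rw [h]
      exact (hkern.comp (measurable_id.prodMk measurable_const)).const_mul c
    | zero => rw [RKHS.coe_zero]; exact measurable_const
    | add g g' _ _ hg hg' => rw [RKHS.coe_add]; exact hg.add hg'
    | smul c g _ hg => rw [RKHS.coe_smul]; exact hg.const_smul c
  obtain ⟨s, hs, hlim⟩ := mem_closure_iff_seq_limit.1 hf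
  refine measurable_of_tendsto_metrizable (fun n => hspan _ (hs n)) (tendsto_pi_nhds.2 fun x => ?_)
  exact ((RKHS.continuous_eval x).tendsto f).comp hlim

/-- A map into a separable metric space is measurable if its distances to all points are. -/
lemma stronglyMeasurable_of_measurable_dist {α M : Type*} [MeasurableSpace α]
    [PseudoMetricSpace M] [SecondCountableTopology M]
    {f : α → M} (hf : ∀ c, Measurable fun x => dist (f x) c) : StronglyMeasurable f := by
  borelize M
  refine Measurable.stronglyMeasurable ?_
  have hbasis : TopologicalSpace.IsTopologicalBasis
      {s : Set M | ∃ (c : M) (r : ℝ), s = Metric.ball c r} := by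
    refine TopologicalSpace.isTopologicalBasis_of_isOpen_of_nhds ?_ fun a U ha hU => ?_
    · rintro _ ⟨c, r, rfl⟩
      exact Metric.isOpen_ball
    · obtain ⟨r, hr, h⟩ := Metric.isOpen_iff.1 hU a ha
      exact ⟨_, ⟨a, r, rfl⟩, Metric.mem_ball_self hr, h⟩
  have h : ‹MeasurableSpace M› = _ :=
    (BorelSpace.measurable_eq (α := M)).trans hbasis.borel_eq_generateFrom
  rw [h]
  refine measurable_generateFrom ?_
  rintro _ ⟨c, r, rfl⟩
  exact measurableSet_lt (hf c) measurable_const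

lemma stronglyMeasurable_feature [TopologicalSpace.SeparableSpace H]
    (hkern : Measurable fun p : 𝕏 × 𝕏 => kern H p.1 p.2) :
    StronglyMeasurable (feature H : 𝕏 → H) := by
  have : SecondCountableTopology H := UniformSpace.secondCountable_of_separable H
  refine stronglyMeasurable_of_measurable_dist fun c => ?_
  -- The reproducing property expands ‖Φ(x) - c‖² into measurable functions of x.
  have h : ∀ x : 𝕏, dist (feature H x) c = √(kern H x x - 2 * c x + ‖c‖ ^ 2) := fun x => by
    have hk : ‖feature H x‖ ^ 2 = kern H x x := by
      rw [← real_inner_self_eq_norm_sq, inner_feature, feature, RKHS.kerFun_apply, kern]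
    rw [dist_eq_norm, ← Real.sqrt_sq (norm_nonneg (_ - c)), norm_sub_sq_real, real_inner_comm,
      inner_feature, hk]
  have hd : Measurable fun x : 𝕏 => kern H x x :=
    hkern.comp (g := fun p : 𝕏 × 𝕏 => kern H p.1 p.2) (f := fun x => (x, x))
      (measurable_id'.prodMk measurable_id')
  have hc := (measurable_coe hkern c).const_mul 2
  have hs := ((hd.sub hc).add_const (‖c‖ ^ 2)).sqrt
  simp_rw [h]
  exact hs

end Feature

end EmbeddedEvolution

/-! ### The error bound for the estimated operator -/

theorem mainTheorem6
    -- the state space, and a reproducing kernel Hilbert space on it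
    {𝕏 : Type*} [MeasurableSpace 𝕏]
    {H : Type*} [NormedAddCommGroup H] [InnerProductSpace ℝ H] [CompleteSpace H]
    [TopologicalSpace.SeparableSpace H] [RKHS ℝ H 𝕏 ℝ]
    (hkern : Measurable fun p : 𝕏 × 𝕏 => EmbeddedEvolution.kern H p.1 p.2)
    -- the stochastic dynamics, the law of the initial state, the joint law of `X₀` and `X_t`
    {Ω₀ : Type*} [MeasurableSpace Ω₀] (P₀ : Measure Ω₀) [IsProbabilityMeasure P₀]
    (X : ℝ≥0 → Ω₀ → 𝕏) (hX : ∀ s, Measurable (X s)) (t : ℝ≥0)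
    (μ : Measure 𝕏) (hμ : μ = P₀.map (X 0))
    (μ₀t : Measure (𝕏 × 𝕏)) (hμ₀t : μ₀t = P₀.map fun ω => (X 0 ω, X t ω))
    (hκ : Integrable (fun x => EmbeddedEvolution.kern H x x) μ)
    -- the moment bounds of the centered operators
    (σt σ₀ L : ℝ) (hσt : 0 ≤ σt) (hσ₀ : 0 ≤ σ₀) (hL : 0 ≤ L)
    (hYX : ∀ n : ℕ, 2 ≤ n →
      ∫⁻ p, EmbeddedEvolution.hsNorm
          (EmbeddedEvolution.rankOneOp H p.2 p.1 - EmbeddedEvolution.covYX H μ₀t) ^ n ∂μ₀t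
        ≤ ENNReal.ofReal (1 / 2 * n ! * σt ^ 2 * L ^ (n - 2)))
    (hXX : ∀ n : ℕ, 2 ≤ n →
      ∫⁻ x, EmbeddedEvolution.hsNorm
          (EmbeddedEvolution.rankOneOp H x x - EmbeddedEvolution.covXX H μ) ^ n ∂μ
        ≤ ENNReal.ofReal (1 / 2 * n ! * σ₀ ^ 2 * L ^ (n - 2)))
    (lam : ℝ) (hlam : 0 < lam) (δ : ℝ) (hδ : 0 < δ) (m : ℕ) (hm : 1 ≤ m)
    -- the data: `m` independent samples of the joint law
    {Ω : Type*} [MeasurableSpace Ω] (P : Measure Ω) [IsProbabilityMeasure P]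
    (x y : Fin m → Ω → 𝕏) (hx : ∀ k, Measurable (x k)) (hy : ∀ k, Measurable (y k))
    (hindep : iIndepFun (fun k ω => (x k ω, y k ω)) P)
    (hlaw : ∀ k, P.map (fun ω => (x k ω, y k ω)) = μ₀t) :
    ENNReal.ofReal (1 - 2 * δ) ≤
      P {ω |
        ‖EmbeddedEvolution.regularized
            (EmbeddedEvolution.empCovYX H (fun k => x k ω) (fun k => y k ω))
            (EmbeddedEvolution.empCovXX H (fun k => x k ω)) lam
          - EmbeddedEvolution.regularized
            (EmbeddedEvolution.covYX H μ₀t) (EmbeddedEvolution.covXX H μ) lam‖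
        ≤ 2 / (lam * √m) * Real.log (2 / δ) *
          (σt + (EmbeddedEvolution.hsNorm (EmbeddedEvolution.covYX H μ₀t)).toReal / lam * σ₀
            + (1 + (EmbeddedEvolution.hsNorm (EmbeddedEvolution.covYX H μ₀t)).toReal / lam)
              * (L / √m))} := by
  have hpair : Measurable fun ω => (X 0 ω, X t ω) := (hX 0).prodMk (hX t)
  have : IsProbabilityMeasure μ := hμ ▸ Measure.isProbabilityMeasure_map (hX 0).aemeasurable
  have : IsProbabilityMeasure μ₀t := hμ₀t ▸ Measure.isProbabilityMeasure_map hpair.aemeasurable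
  -- Makes the first coordinates of the samples independent draws from μ.
  have hfst : μ₀t.map Prod.fst = μ := by
    rw [hμ₀t, hμ, Measure.map_map measurable_fst hpair]; rfl
  -- For δ ≥ 1/2 the claimed probability is nonpositive; otherwise Bernstein's confidence form
  -- applies.
  rcases le_or_gt (1 / 2) δ with hδ1 | hδ1
  · rw [ENNReal.ofReal_of_nonpos (by linarith)]; exact zero_le
  have hΦ := EmbeddedEvolution.stronglyMeasurable_feature hkern
  have hΦ1 : StronglyMeasurable fun p : 𝕏 × 𝕏 => EmbeddedEvolution.feature H p.1 :=
    hΦ.comp_measurable measurable_fst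
  have hΦ2 : StronglyMeasurable fun p : 𝕏 × 𝕏 => EmbeddedEvolution.feature H p.2 :=
    hΦ.comp_measurable measurable_snd
  have hcYX := EmbeddedEvolution.integrable_rankOne_of_lintegral_hsNorm hΦ1 hΦ2
    ((hYX 2 le_rfl).trans_lt ENNReal.ofReal_lt_top)
  have hcXX := EmbeddedEvolution.integrable_rankOne_of_lintegral_hsNorm hΦ hΦ
    ((hXX 2 le_rfl).trans_lt ENNReal.ofReal_lt_top)
  have hbadYX := EmbeddedEvolution.measure_norm_mean_rankOne_gt_le hΦ1 hΦ2 hcYX hσt hL hYX hm hδ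
    hδ1 (fun k => (hx k).prodMk (hy k)) hindep hlaw
  have hbadXX := EmbeddedEvolution.measure_norm_mean_rankOne_gt_le hΦ hΦ hcXX hσ₀ hL hXX hm hδ
    hδ1 hx (hindep.comp (fun _ => Prod.fst) fun _ => measurable_fst) fun k => by
      rw [← hfst, ← hlaw k, Measure.map_map measurable_fst ((hx k).prodMk (hy k))]; rfl
  have hC := EmbeddedEvolution.norm_le_toReal_hsNorm_integral hΦ1 hΦ2 hcYX
  -- Stated as P(univ) ≤ P(good) + δ + δ, the bound needs only subadditivity, not measurability of
  -- the good event.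
  rw [ENNReal.ofReal_sub _ (by positivity), ENNReal.ofReal_one, tsub_le_iff_right, two_mul,
    ENNReal.ofReal_add hδ.le hδ.le, ← measure_univ (μ := P)]
  refine le_trans (measure_mono fun ω _ => ?_) ((measure_union_le _ _).trans
    (add_le_add le_rfl ((measure_union_le _ _).trans (add_le_add hbadYX hbadXX))))
  rw [Set.mem_union, or_iff_not_imp_right]
  intro hω
  rw [Set.mem_union, not_or, Set.mem_ofPred_eq, Set.mem_ofPred_eq, not_lt, not_lt] at hω
  have h1 := hω.1
  have h2 := hω.2
  refine (EmbeddedEvolution.norm_regularized_sub_le (EmbeddedEvolution.covXX_isPositive μ)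
    (EmbeddedEvolution.empCovXX_isPositive fun k => x k ω) _ _ hlam).trans ?_
  set K := (EmbeddedEvolution.hsNorm (EmbeddedEvolution.covYX H μ₀t)).toReal
  set ℓ := Real.log (2 / δ)
  calc _ ≤ (2 / √m * ℓ * (σt + L / √m)) / lam
        + K / lam * ((2 / √m * ℓ * (σ₀ + L / √m)) / lam) := by
        have hK : 0 ≤ K := ENNReal.toReal_nonneg
        gcongr
        · exact h1
        · exact hC
        · exact h2
    _ = _ := by
        have : (√m : ℝ) ≠ 0 := (Real.sqrt_pos.2 (by exact_mod_cast hm)).ne'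
        field_simp
        ring
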